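/- Let $N\ge 1$, $r\ge 0$, $s\ge 1$ be integers and let $\nu_1,\dots,\nu_r$ and $\mu_1,\dots,\mu_s$ be real numbers greater than $-1$ (for example non-negative integers). For $x>0$ and $1\le j\le N$ let $$I_j(x)=G^{r,s}_{s,r}\Big({-(\mu_1+j-1+N),\,-(\mu_2+N),\dots,-(\mu_s+N)\atop \nu_1,\dots,\nu_r}\Big|\,x\Big)=\frac1{2\pi i}\int_{c-i\infty}^{c+i\infty}\prod_{l=1}^r\Gamma(\nu_l-u)\;\Gamma(\mu_1+N+j+u)\prod_{l=2}^s\Gamma(\mu_l+N+1+u)\;x^u\,du$$ be the Meijer $G$-function, where the line $\operatorname{Re}u=c$ (which may depend on $j$) is any vertical line having all the poles of the factors $\Gamma(\nu_l-u)$ on its right and all the poles of the remaining Gamma factors on its left. Consider the function $$w(x_1,\dots,x_N)=\prod_{1\le j<k\le N}(x_k-x_j)\;\det\big[I_j(x_k)\big]_{j,k=1,\dots,N},\qquad x_1,\dots,x_N>0.$$ (Background, not part of the claim: $w$ is the unnormalized joint eigenvalue density of the product Wishart matrix $X^\dagger X$ with $X=G_r\cdots G_1(\tilde G_s\cdots\tilde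 G_1)^{-1}$, the $G_j$ and $\tilde G_l$ being independent $N\times N$ complex matrices with densities proportional to $(\det G_j^\dagger G_j)^{\nu_j}e^{-\mathrm{Tr}\,G_j^\dagger G_j}$ and $(\det\tilde G_l^\dagger\tilde G_l)^{\mu_l}e^{-\mathrm{Tr}\,\tilde G_l^\dagger\tilde G_l}$.) Put $\nu_0=0$ and $$C_l=(-1)^l\prod_{j=0}^r\Gamma(\nu_j+l+1)\prod_{p=1}^s\Gamma(\mu_p+N-l),\qquad l=0,\dots,N-1.$$ Then $w$ is real valued and Lebesgue integrable on $(0,\infty)^N$, and the factor by which it must be multiplied in order to be correctly normalized is $\frac{1}{N!}\prod_{l=0}^{N-1}\frac1{C_l}$: for a constant $K$, $$\int_{(0,\infty)^N}K\,w(x)\,dx_1\cdots dx_N=1\quad\Longleftrightarrow\quad K=\frac1{N!}\,\frac1{\prod_{l=0}^{N-1}C_l}.$$ -/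

import Mathlib

noncomputable section

/-- The Mellin symbol of the Meijer `G`-function `G^{m,n}_{p,q}`, with upper parameters `a` and
lower parameters `b` (numbered from `0`):
`∏_{j ≤ m} Γ(b_j - u) ∏_{j ≤ n} Γ(1 - a_j + u) / (∏_{j > m} Γ(1 - b_j + u) ∏_{j > n} Γ(a_j - u))`. -/
def meijerSymbol {p q : ℕ} (m n : ℕ) (a : Fin p → ℂ) (b : Fin q → ℂ) (u : ℂ) : ℂ :=
  ((∏ j : Fin q with j.val < m, Complex.Gamma (b j - u)) *
      ∏ j : Fin p with j.val < n, Complex.Gamma (1 - a j + u)) /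
    ((∏ j : Fin q with m ≤ j.val, Complex.Gamma (1 - b j + u)) *
      ∏ j : Fin p with n ≤ j.val, Complex.Gamma (a j - u))

/-- The vertical line `Re u = c` is an admissible contour for `G^{m,n}_{p,q}`: the poles of
`Γ(b_j - u)`, `j ≤ m`, lie to its right and those of `Γ(1 - a_j + u)`, `j ≤ n`, to its left. -/
def IsMeijerLine {p q : ℕ} (m n : ℕ) (a : Fin p → ℂ) (b : Fin q → ℂ) (c : ℝ) : Prop :=
  (∀ j : Fin q, j.val < m → c < (b j).re) ∧ (∀ j : Fin p, j.val < n → (a j).re - 1 < c)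

/-- The Meijer `G`-function as the contour integral
`(2πi)⁻¹ ∫_{c - i∞}^{c + i∞} meijerSymbol(u) z^u du`, parametrized by `u = c + i t`. -/
def meijerG {p q : ℕ} (m n : ℕ) (a : Fin p → ℂ) (b : Fin q → ℂ) (c : ℝ) (z : ℂ) : ℂ :=
  1 / (2 * (Real.pi : ℂ) * Complex.I) *
    ∫ t : ℝ, meijerSymbol m n a b ((c : ℂ) + (t : ℂ) * Complex.I) *
      z ^ ((c : ℂ) + (t : ℂ) * Complex.I) * Complex.I

/-- Upper parameters `-(μ₁ + j - 1 + N), -(μ₂ + N), …, -(μ_s + N)` of row `j` of the determinant;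
here `j : Fin N` is numbered from `0`, so it plays the role of `j - 1`. -/
def upperParam {N s : ℕ} (μ : Fin s → ℝ) (j : Fin N) : Fin s → ℂ := fun l =>
  if l.val = 0 then -((μ l : ℂ) + (j.val : ℂ) + (N : ℂ)) else -((μ l : ℂ) + (N : ℂ))

/-- Lower parameters `ν₁, …, ν_r`. -/
def lowerParam {r : ℕ} (ν : Fin r → ℝ) : Fin r → ℂ := fun l => (ν l : ℂ)

/-- `∏_{j < k} (x_k - x_j) · det [G^{r,s}_{s,r}(upperParam μ j; ν | x_k)]_{j,k}`, where the
`G`-function of row `j` is computed along the line `Re u = c j`. -/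
def eigenvalueWeight {N r s : ℕ} (ν : Fin r → ℝ) (μ : Fin s → ℝ) (c : Fin N → ℝ)
    (x : Fin N → ℝ) : ℂ :=
  (∏ j : Fin N, ∏ k ∈ Finset.Ioi j, ((x k : ℂ) - (x j : ℂ))) *
    (Matrix.of fun j k : Fin N =>
      meijerG r s (upperParam μ j) (lowerParam ν) (c j) (x k : ℂ)).det

/-- `C_l = (-1)^l ∏_{j=0}^r Γ(ν_j + l + 1) ∏_{p=1}^s Γ(μ_p + N - l)` with `ν₀ = 0`. -/
def normConst {r s : ℕ} (N : ℕ) (ν : Fin r → ℝ) (μ : Fin s → ℝ) (l : ℕ) : ℝ :=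
  (-1) ^ l *
    (∏ j : Fin (r + 1), Real.Gamma ((Fin.cons 0 ν : Fin (r + 1) → ℝ) j + (l : ℝ) + 1)) *
    ∏ p : Fin s, Real.Gamma (μ p + (N : ℝ) - (l : ℝ))

end

/-!
In the variable `t = log x` each factor `Γ(a + u)` or `Γ(b - u)` of the Mellin symbol is the
bilateral Laplace transform of an exponentially tilted `e^{-e^{∓t}}`, so the symbol is the transform
of an iterated convolution. Mellin inversion identifies the `G`-function with that convolution,
whatever the admissible contour, and hence its moment `∫ x^p I_j(x) dx` with the value of the symbol
at `-(p + 1)`, which lies in the strip of convergence.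

The weight is a product of two determinants, one of them of Vandermonde type, so Andréief's identity
turns its integral into `N!` times the determinant of the moments. The `Γ`-factors independent of
`j` come out of the rows; what remains is `det Γ(z_p + j) = ∏ Γ(z_p) · det (z_p)_j`, and the rising
factorials `(z_p)_j` are monic of degree `j` in `z_p`, which leaves the Vandermonde determinant of
the consecutive points `z_p = μ₁ + N - p`. Reality is the conjugation symmetry of the symbol.
-/

open MeasureTheory Set ComplexConjugate
open scoped Convolution

section ExpTilt

variable {E E' F : Type*} [NormedAddCommGroup E] [NormedSpace ℂ E] [NormedAddCommGroup E']
  [NormedSpace ℂ E'] [NormedAddCommGroup F] [NormedSpace ℂ F]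

/-- The function `t ↦ e^{-ut} φ(t)`, whose integral is the bilateral Laplace transform of `φ`
at `u`. -/
noncomputable def expTilt (u : ℂ) (φ : ℝ → E) (t : ℝ) : E :=
  Complex.exp (-(u * t)) • φ t

theorem norm_expTilt (u : ℂ) (φ : ℝ → E) (t : ℝ) :
    ‖expTilt u φ t‖ = Real.exp (-(u.re * t)) * ‖φ t‖ := by
  simp [expTilt, norm_smul, Complex.norm_exp]

theorem expTilt_expTilt (u v : ℂ) (φ : ℝ → E) :
    expTilt u (expTilt v φ) = expTilt (v + u) φ := by
  ext t
  simp only [expTilt, smul_smul, ← Complex.exp_add]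
  ring_nf

theorem expTilt_comp_neg (u : ℂ) (φ : ℝ → E) :
    expTilt u (fun t => φ (-t)) = fun t => expTilt (-u) φ (-t) := by
  ext t
  simp [expTilt]

theorem continuous_expTilt_iff {u : ℂ} {φ : ℝ → E} :
    Continuous (expTilt u φ) ↔ Continuous φ := by
  have continuous_expTilt (v : ℂ) {χ : ℝ → E} (hχ : Continuous χ) : Continuous (expTilt v χ) := by
    unfold expTilt
    fun_prop
  refine ⟨fun h => ?_, continuous_expTilt u⟩
  have h0 : expTilt (-u) (expTilt u φ) = φ := by
    rw [expTilt_expTilt, add_neg_cancel]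
    ext t
    simp [expTilt]
  exact h0 ▸ continuous_expTilt (-u) h

theorem expTilt_convolution (L : E →L[ℂ] E' →L[ℂ] F)
    (φ : ℝ → E) (ψ : ℝ → E') (u : ℂ) :
    expTilt u (φ ⋆[L, volume] ψ) = expTilt u φ ⋆[L, volume] expTilt u ψ := by
  ext t
  simp only [expTilt, convolution_def, ← integral_smul, map_smul, smul_apply,
    smul_smul, ← Complex.exp_add]
  congr with x
  push_cast
  ring_nf

theorem exp_smul_exp_cpow_smul (s : ℂ) (φ : ℝ → E) (t : ℝ) :
    Real.exp t • (Real.exp t : ℂ) ^ (s - 1) • φ t = expTilt (-s) φ t := by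
  have hne : (Real.exp t : ℂ) ≠ 0 := Complex.ofReal_ne_zero.2 (Real.exp_ne_zero t)
  rw [← Complex.coe_smul, smul_smul, Complex.cpow_sub _ _ hne, Complex.cpow_one,
    mul_div_cancel₀ _ hne, Complex.cpow_def_of_ne_zero hne,
    ← Complex.ofReal_log (Real.exp_pos t).le, Real.log_exp, expTilt, neg_mul, neg_neg, mul_comm s]

theorem mellinConvergent_comp_log_iff {φ : ℝ → E} {s : ℂ} :
    MellinConvergent (fun x => φ (Real.log x)) s ↔ Integrable (expTilt (-s) φ) := by
  rw [MellinConvergent, ← Real.range_exp, ← image_univ,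
    integrableOn_image_iff_integrableOn_abs_deriv_smul MeasurableSet.univ
      (fun t _ => (Real.hasDerivAt_exp t).hasDerivWithinAt) Real.exp_injective.injOn,
    integrableOn_univ]
  simp only [Real.abs_exp, Real.log_exp, exp_smul_exp_cpow_smul]

theorem mellin_comp_log (φ : ℝ → E) (s : ℂ) :
    mellin (fun x => φ (Real.log x)) s = ∫ t, expTilt (-s) φ t := by
  rw [mellin, ← Real.range_exp, ← image_univ,
    integral_image_eq_integral_abs_deriv_smul MeasurableSet.univ
      (fun t _ => (Real.hasDerivAt_exp t).hasDerivWithinAt) Real.exp_injective.injOn,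
    setIntegral_univ]
  simp only [Real.abs_exp, Real.log_exp, exp_smul_exp_cpow_smul]

end ExpTilt

theorem bddAbove_range_norm_convolution {𝕜 E E' F G : Type*} [NontriviallyNormedField 𝕜]
    [NormedAddCommGroup E] [NormedSpace 𝕜 E] [NormedAddCommGroup E'] [NormedSpace 𝕜 E']
    [NormedAddCommGroup F] [NormedSpace 𝕜 F] [NormedSpace ℝ F] [AddGroup G] [MeasurableSpace G]
    {μ : Measure G} (L : E →L[𝕜] E' →L[𝕜] F) {f : G → E} {g : G → E'} (hf : Integrable f μ)
    (hg : BddAbove (range fun x => ‖g x‖)) : BddAbove (range fun x => ‖(f ⋆[L, μ] g) x‖) := by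
  obtain ⟨C, hC⟩ := hg
  refine ⟨∫ t, ‖L‖ * ‖f t‖ * C ∂μ, forall_mem_range.2 fun x => ?_⟩
  refine norm_integral_le_of_norm_le ((hf.norm.const_mul _).mul_const _) (ae_of_all _ fun t => ?_)
  exact L.le_of_opNorm₂_le_of_le le_rfl le_rfl (hC (mem_range_self (x - t)))

theorem norm_Gamma_le_Gamma_re {z : ℂ} (hz : 0 < z.re) :
    ‖Complex.Gamma z‖ ≤ Real.Gamma z.re := by
  rw [Complex.Gamma_eq_integral hz, Real.Gamma_eq_integral hz, Complex.GammaIntegral]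
  refine (norm_integral_le_integral_norm _).trans_eq
    (setIntegral_congr_fun measurableSet_Ioi fun x (hx : 0 < x) => ?_)
  simp [Complex.norm_cpow_eq_rpow_re_of_pos hx, Complex.norm_exp]

theorem norm_Gamma_le_Gamma_re_add_two_div {z : ℂ} (hz : 0 < z.re) :
    ‖Complex.Gamma z‖ ≤ Real.Gamma (z.re + 2) / ‖z‖ ^ 2 := by
  have ne_zero_of_re_pos {w : ℂ} (hw : 0 < w.re) : w ≠ 0 := by
    rintro rfl
    exact hw.false
  have hz1 : 0 < (z + 1).re := by
    rw [Complex.add_re, Complex.one_re]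
    linarith
  have hrec : Complex.Gamma (z + 2) = (z + 1) * (z * Complex.Gamma z) := by
    rw [← Complex.Gamma_add_one z (ne_zero_of_re_pos hz),
      ← Complex.Gamma_add_one _ (ne_zero_of_re_pos hz1), add_assoc, one_add_one_eq_two]
  have hnorm : ‖z‖ ≤ ‖z + 1‖ := by
    refine Real.sqrt_le_sqrt ?_
    simp only [Complex.normSq_apply, Complex.add_re, Complex.add_im, Complex.one_re,
      Complex.one_im]
    nlinarith
  rw [le_div_iff₀ (pow_pos (norm_pos_iff.2 (ne_zero_of_re_pos hz)) 2)]
  calc ‖Complex.Gamma z‖ * ‖z‖ ^ 2 = ‖z‖ * (‖z‖ * ‖Complex.Gamma z‖) := by ring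
    _ ≤ ‖z + 1‖ * (‖z‖ * ‖Complex.Gamma z‖) := by gcongr
    _ = ‖Complex.Gamma (z + 2)‖ := by rw [hrec, norm_mul, norm_mul]
    _ ≤ Real.Gamma (z.re + 2) := by
      simpa using norm_Gamma_le_Gamma_re (z := z + 2) (by simpa using by linarith)

theorem verticalIntegrable_Gamma {σ : ℝ} (hσ : 0 < σ) :
    Complex.VerticalIntegrable Complex.Gamma σ := by
  have hre (t : ℝ) : (σ + t * Complex.I : ℂ).re = σ := by simp
  have hcont : Continuous fun t : ℝ => Complex.Gamma (σ + t * Complex.I) := by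
    refine continuous_iff_continuousAt.2 fun t => ContinuousAt.comp
      (f := fun t : ℝ => (σ : ℂ) + t * Complex.I)
      (Complex.differentiableAt_Gamma _ fun m h => ?_).continuousAt (by fun_prop)
    have hσm : σ = -m := by simpa [hre] using congrArg Complex.re h
    exact (hσm ▸ hσ).not_ge (neg_nonpos.2 m.cast_nonneg)
  refine ((integrable_inv_one_add_sq.comp_div hσ.ne').const_mul
    (Real.Gamma (σ + 2) / σ ^ 2)).mono' hcont.aestronglyMeasurable (ae_of_all _ fun t => ?_)
  refine (norm_Gamma_le_Gamma_re_add_two_div (hσ.trans_eq (hre t).symm)).trans_eq ?_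
  rw [hre, Complex.norm_add_mul_I, Real.sq_sqrt (by positivity)]
  field_simp

/-- `F` is the bilateral Laplace transform of the continuous function `φ` on the strip `Re u ∈ S`.
The bounds on `φ` and the integrability of `F` along vertical lines are what makes the notion
stable under convolution and allows the transform to be inverted pointwise. -/
structure IsLaplacePair (φ : ℝ → ℂ) (F : ℂ → ℂ) (S : Set ℝ) : Prop where
  continuous : Continuous φ
  bddAbove : ∀ σ ∈ S, BddAbove (range fun t => ‖expTilt (σ : ℂ) φ t‖)
  integrable : ∀ u : ℂ, u.re ∈ S → Integrable (expTilt u φ)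
  integral_eq : ∀ u : ℂ, u.re ∈ S → ∫ t, expTilt u φ t = F u
  verticalIntegrable : ∀ σ ∈ S, Complex.VerticalIntegrable F σ

namespace IsLaplacePair

variable {φ ψ : ℝ → ℂ} {F G : ℂ → ℂ} {S T : Set ℝ}

theorem mono (h : IsLaplacePair φ F T) (hST : S ⊆ T) : IsLaplacePair φ F S where
  continuous := h.continuous
  bddAbove σ hσ := h.bddAbove σ (hST hσ)
  integrable u hu := h.integrable u (hST hu)
  integral_eq u hu := h.integral_eq u (hST hu)
  verticalIntegrable σ hσ := h.verticalIntegrable σ (hST hσ)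

theorem norm_le (h : IsLaplacePair φ F S) {u : ℂ} (hu : u.re ∈ S) :
    ‖F u‖ ≤ ∫ t, ‖expTilt (u.re : ℂ) φ t‖ := by
  rw [← h.integral_eq u hu]
  refine (norm_integral_le_integral_norm _).trans_eq ?_
  simp only [norm_expTilt, Complex.ofReal_re]

theorem comp_neg (h : IsLaplacePair φ F S) :
    IsLaplacePair (fun t => φ (-t)) (fun u => F (-u)) (-S) where
  continuous := h.continuous.comp continuous_neg
  bddAbove σ hσ := by
    have hrange := (Equiv.neg ℝ).surjective.range_comp fun t => ‖expTilt ((-σ : ℝ) : ℂ) φ t‖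
    simp only [expTilt_comp_neg, ← Complex.ofReal_neg]
    exact hrange ▸ h.bddAbove (-σ) hσ
  integrable u hu := by
    rw [expTilt_comp_neg]
    exact (h.integrable (-u) hu).comp_neg
  integral_eq u hu := by
    rw [expTilt_comp_neg, integral_neg_eq_self, h.integral_eq (-u) hu]
  verticalIntegrable σ hσ := by
    have hline (t : ℝ) : -(σ + t * Complex.I) = ((-σ : ℝ) : ℂ) + ((-t : ℝ) : ℂ) * Complex.I := by
      push_cast
      ring
    simpa only [Complex.VerticalIntegrable, hline] using! (h.verticalIntegrable (-σ) hσ).comp_neg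

theorem expTilt (h : IsLaplacePair φ F S) (b : ℂ) :
    IsLaplacePair (expTilt b φ) (fun u => F (b + u)) {σ | b.re + σ ∈ S} where
  continuous := continuous_expTilt_iff.2 h.continuous
  bddAbove σ hσ := by
    simpa only [expTilt_expTilt, norm_expTilt, Complex.add_re, Complex.ofReal_re]
      using h.bddAbove _ hσ
  integrable u hu := by
    rw [expTilt_expTilt]
    exact h.integrable (b + u) hu
  integral_eq u hu := by rw [expTilt_expTilt, h.integral_eq (b + u) hu]
  verticalIntegrable σ hσ := by
    have hline (t : ℝ) : b + (σ + t * Complex.I) =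
        ((b.re + σ : ℝ) : ℂ) + ((t + b.im : ℝ) : ℂ) * Complex.I := by
      apply Complex.ext <;> simp [add_comm]
    simpa only [Complex.VerticalIntegrable, hline]
      using! (h.verticalIntegrable _ hσ).comp_add_right b.im

theorem convolution (hφ : IsLaplacePair φ F S) (hψ : IsLaplacePair ψ G S) (hS : S.Nonempty) :
    IsLaplacePair (φ ⋆[ContinuousLinearMap.mul ℂ ℂ, volume] ψ) (fun u => F u * G u) S where
  continuous := by
    obtain ⟨σ, hσ⟩ := hS
    rw [← continuous_expTilt_iff (u := σ), expTilt_convolution]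
    exact (hψ.bddAbove σ hσ).continuous_convolution_right_of_integrable _ (hφ.integrable σ hσ)
      (continuous_expTilt_iff.2 hψ.continuous)
  bddAbove σ hσ := by
    rw [expTilt_convolution]
    exact bddAbove_range_norm_convolution _ (hφ.integrable σ hσ) (hψ.bddAbove σ hσ)
  integrable u hu := by
    rw [expTilt_convolution]
    exact (hφ.integrable u hu).integrable_convolution _ (hψ.integrable u hu)
  integral_eq u hu := by
    rw [expTilt_convolution, integral_convolution _ (hφ.integrable u hu) (hψ.integrable u hu),
      hφ.integral_eq u hu, hψ.integral_eq u hu, ContinuousLinearMap.mul_apply']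
  verticalIntegrable σ hσ := by
    refine (hψ.verticalIntegrable σ hσ).bdd_mul (c := ∫ t, ‖_root_.expTilt (σ : ℂ) φ t‖)
      (hφ.verticalIntegrable σ hσ).aestronglyMeasurable (ae_of_all _ fun t => ?_)
    simpa using hφ.norm_le (u := σ + t * Complex.I) (by simpa using hσ)

theorem hasMellin_comp_log (h : IsLaplacePair φ F S) {u : ℂ} (hu : u.re ∈ S) :
    HasMellin (fun x => φ (Real.log x)) (-u) (F u) := by
  rw [HasMellin, mellinConvergent_comp_log_iff, mellin_comp_log, neg_neg]
  exact ⟨h.integrable u hu, h.integral_eq u hu⟩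

theorem mellinInv_eq (h : IsLaplacePair φ F S) {σ : ℝ} (hσ : σ ∈ S) {x : ℝ} (hx : 0 < x) :
    mellinInv (-σ) (fun s => F (-s)) x = φ (Real.log x) := by
  have hline (t : ℝ) : -(((-σ : ℝ) : ℂ) + t * Complex.I) = σ + ((-t : ℝ) : ℂ) * Complex.I := by
    push_cast
    ring
  have hmellin (t : ℝ) : mellin (fun x => φ (Real.log x)) (((-σ : ℝ) : ℂ) + t * Complex.I) =
      F (-(((-σ : ℝ) : ℂ) + t * Complex.I)) := by
    rw [← (h.hasMellin_comp_log (by simpa using hσ)).2, neg_neg]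
  rw [← mellinInv_mellin_eq (-σ) (fun x => φ (Real.log x)) hx]
  · simp only [mellinInv, hmellin]
  · simpa using (h.hasMellin_comp_log (u := σ) (by simpa using hσ)).1
  · simpa only [Complex.VerticalIntegrable, hmellin, hline]
      using! (h.verticalIntegrable σ hσ).comp_neg
  · exact h.continuous.continuousAt.comp (Real.continuousAt_log hx.ne')

end IsLaplacePair

theorem exists_isLaplacePair_prod {ι : Type*} {s : Finset ι} (hs : s.Nonempty)
    {F : ι → ℂ → ℂ} {S : Set ℝ} (hF : ∀ i ∈ s, ∃ φ, IsLaplacePair φ (F i) S)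
    (hS : S.Nonempty) :
    ∃ φ, IsLaplacePair φ (fun u => ∏ i ∈ s, F i u) S := by
  induction hs using Finset.Nonempty.cons_induction with
  | singleton i => simpa only [Finset.prod_singleton] using hF i (Finset.mem_singleton_self i)
  | cons i t hi _ ih =>
    obtain ⟨φ, hφ⟩ := hF i (Finset.mem_cons_self i t)
    obtain ⟨ψ, hψ⟩ := ih fun j hj => hF j (Finset.mem_cons_of_mem hj)
    simp only [Finset.prod_cons]
    exact ⟨_, hφ.convolution hψ hS⟩

theorem isLaplacePair_Gamma_neg :
    IsLaplacePair (fun t => (Real.exp (-Real.exp t) : ℂ)) (fun u => Complex.Gamma (-u))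
      (Iio 0) where
  continuous := by fun_prop
  bddAbove σ hσ := by
    have hp : 0 < -σ := neg_pos.2 hσ
    refine ⟨Real.exp (-σ * Real.log (-σ) - -σ), forall_mem_range.2 fun t => ?_⟩
    rw [norm_expTilt, Complex.norm_real, Complex.ofReal_re, Real.norm_eq_abs, Real.abs_exp,
      ← Real.exp_add, Real.exp_le_exp]
    have htangent := Real.add_one_le_exp (t - Real.log (-σ))
    rw [Real.exp_sub, Real.exp_log hp, le_div_iff₀ hp] at htangent
    linarith
  integrable u hu := by
    have hconv : MellinConvergent (fun x => (Real.exp (-Real.exp (Real.log x)) : ℂ)) (-u) := by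
      have hGamma := Complex.GammaIntegral_convergent (s := -u) (by simpa using hu)
      rw [MellinConvergent]
      refine hGamma.congr_fun (fun x hx => ?_) measurableSet_Ioi
      simp only [Real.exp_log (mem_Ioi.1 hx), smul_eq_mul, mul_comm, Complex.ofReal_exp,
        Complex.ofReal_neg]
    rw [← neg_neg u]
    exact mellinConvergent_comp_log_iff.1 hconv
  integral_eq u hu := by
    rw [Complex.Gamma_eq_integral (by simpa using hu), Complex.GammaIntegral_eq_mellin,
      ← neg_neg u, ← mellin_comp_log, neg_neg]
    refine setIntegral_congr_fun measurableSet_Ioi fun x (hx : 0 < x) => ?_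
    simp only [Real.exp_log hx]
  verticalIntegrable σ hσ := by
    have hline (t : ℝ) : -(σ + t * Complex.I) = ((-σ : ℝ) : ℂ) + ((-t : ℝ) : ℂ) * Complex.I := by
      push_cast
      ring
    simpa only [Complex.VerticalIntegrable, hline]
      using! (verticalIntegrable_Gamma (neg_pos.2 hσ)).comp_neg

theorem exists_isLaplacePair_Gamma_add (a : ℂ) :
    ∃ φ, IsLaplacePair φ (fun u => Complex.Gamma (a + u)) {σ | -a.re < σ} := by
  have h := isLaplacePair_Gamma_neg.comp_neg.expTilt a
  simp only [neg_neg] at h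
  exact ⟨_, h.mono fun σ hσ => show -(a.re + σ) < 0 by linarith [mem_ofPred.1 hσ]⟩

theorem exists_isLaplacePair_Gamma_sub (b : ℂ) :
    ∃ φ, IsLaplacePair φ (fun u => Complex.Gamma (b - u)) {σ | σ < b.re} := by
  have h := isLaplacePair_Gamma_neg.expTilt (-b)
  simp only [neg_add, neg_neg, ← sub_eq_add_neg] at h
  exact ⟨_, h.mono fun σ hσ => show (-b).re + σ < 0 by
    rw [Complex.neg_re]; linarith [mem_ofPred.1 hσ]⟩

section MeijerG

theorem meijerG_eq_mellinInv {p q : ℕ} (m n : ℕ) (a : Fin p → ℂ) (b : Fin q → ℂ) (c x : ℝ) :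
    meijerG m n a b c x = mellinInv (-c) (fun s => meijerSymbol m n a b (-s)) x := by
  rw [meijerG, mellinInv, integral_mul_const, ← integral_neg_eq_self]
  simp only [Complex.real_smul, smul_eq_mul]
  push_cast
  simp only [neg_add, neg_neg, neg_mul]
  field_simp
  simp only [mul_comm]

theorem conj_meijerSymbol {p q m n : ℕ} {a : Fin p → ℂ} {b : Fin q → ℂ}
    (ha : ∀ j, conj (a j) = a j) (hb : ∀ j, conj (b j) = b j) (u : ℂ) :
    conj (meijerSymbol m n a b u) = meijerSymbol m n a b (conj u) := by
  simp only [meijerSymbol, map_div₀, map_mul, map_prod, ← Complex.Gamma_conj, map_sub, map_add,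
    map_one, ha, hb]

theorem conj_meijerG {p q m n : ℕ} {a : Fin p → ℂ} {b : Fin q → ℂ}
    (ha : ∀ j, conj (a j) = a j) (hb : ∀ j, conj (b j) = b j) (c : ℝ) {z : ℂ}
    (hz : z.arg ≠ Real.pi) :
    conj (meijerG m n a b c z) = meijerG m n a b c (conj z) := by
  have hline (t : ℝ) : conj (c + t * Complex.I : ℂ) = c + ((-t : ℝ) : ℂ) * Complex.I := by simp
  rw [meijerG, meijerG, integral_mul_const, integral_mul_const, map_mul, map_mul, ← integral_conj,
    ← integral_neg_eq_self]
  simp only [map_mul, conj_meijerSymbol ha hb, Complex.conj_cpow _ _ hz, hline, neg_neg,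
    map_div₀, map_one, map_ofNat, Complex.conj_ofReal, Complex.conj_I, div_neg, mul_neg,
    neg_mul]

variable {r s : ℕ} {a : Fin s → ℂ} {b : Fin r → ℂ} {c : ℝ}

theorem meijerSymbol_eq_prod_Gamma (a : Fin s → ℂ) (b : Fin r → ℂ) (u : ℂ) :
    meijerSymbol r s a b u =
      (∏ j, Complex.Gamma (b j - u)) * ∏ j, Complex.Gamma (1 - a j + u) := by
  simp [meijerSymbol, Finset.filter_true_of_mem, Finset.filter_false_of_mem]

theorem exists_isLaplacePair_meijerSymbol (hrs : 0 < r + s) (hc : IsMeijerLine r s a b c) :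
    ∃ φ, IsLaplacePair φ (meijerSymbol r s a b) {σ | IsMeijerLine r s a b σ} := by
  have hne : (Finset.univ : Finset (Fin r ⊕ Fin s)).Nonempty := by
    rw [← Finset.card_pos]
    simpa using hrs
  have hfactor (i : Fin r ⊕ Fin s) : ∃ φ, IsLaplacePair φ (Sum.elim
      (fun j u => Complex.Gamma (b j - u)) (fun j u => Complex.Gamma (1 - a j + u)) i)
      {σ | IsMeijerLine r s a b σ} := by
    rcases i with j | j
    · obtain ⟨φ, hφ⟩ := exists_isLaplacePair_Gamma_sub (b j)
      exact ⟨φ, hφ.mono fun σ hσ => hσ.1 j j.isLt⟩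
    · obtain ⟨φ, hφ⟩ := exists_isLaplacePair_Gamma_add (1 - a j)
      refine ⟨φ, hφ.mono fun σ hσ => ?_⟩
      simpa using hσ.2 j j.isLt
  obtain ⟨φ, hφ⟩ := exists_isLaplacePair_prod hne (fun i _ => hfactor i) ⟨c, hc⟩
  refine ⟨φ, ?_⟩
  simpa only [Fintype.prod_sum_type, Sum.elim_inl, Sum.elim_inr, ← meijerSymbol_eq_prod_Gamma]
    using hφ

theorem hasMellin_congr {E : Type*} [NormedAddCommGroup E] [NormedSpace ℂ E] {f g : ℝ → E}
    {s : ℂ} {m : E} (h : ∀ x, 0 < x → f x = g x) : HasMellin f s m ↔ HasMellin g s m := by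
  have hsmul : EqOn (fun x : ℝ => (x : ℂ) ^ (s - 1) • f x) (fun x : ℝ => (x : ℂ) ^ (s - 1) • g x)
      (Ioi 0) := fun x hx => congrArg _ (h x hx)
  rw [HasMellin, HasMellin, MellinConvergent, MellinConvergent, mellin, mellin,
    integrableOn_congr_fun hsmul measurableSet_Ioi, setIntegral_congr_fun measurableSet_Ioi hsmul]

theorem hasMellin_meijerG (hrs : 0 < r + s) (hc : IsMeijerLine r s a b c) {u : ℂ}
    (hu : IsMeijerLine r s a b u.re) :
    HasMellin (fun x => meijerG r s a b c x) (-u) (meijerSymbol r s a b u) := by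
  obtain ⟨φ, hφ⟩ := exists_isLaplacePair_meijerSymbol hrs hc
  refine (hasMellin_congr fun x hx => ?_).1 (hφ.hasMellin_comp_log hu)
  rw [meijerG_eq_mellinInv, hφ.mellinInv_eq hc hx]

theorem hasMellin_meijerG_natCast_add_one (hrs : 0 < r + s) (hc : IsMeijerLine r s a b c) {n : ℕ}
    (hn : IsMeijerLine r s a b (-((n : ℝ) + 1))) :
    HasMellin (fun x => meijerG r s a b c x) ((n : ℂ) + 1)
      (meijerSymbol r s a b (-((n : ℂ) + 1))) := by
  simpa only [neg_neg] using
    hasMellin_meijerG hrs hc (u := -((n : ℂ) + 1)) (by simpa using hn)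

theorem integrableOn_pow_mul_meijerG (hrs : 0 < r + s) (hc : IsMeijerLine r s a b c) {n : ℕ}
    (hn : IsMeijerLine r s a b (-((n : ℝ) + 1))) :
    IntegrableOn (fun x : ℝ => (x : ℂ) ^ n * meijerG r s a b c x) (Ioi 0) := by
  simpa only [MellinConvergent, add_sub_cancel_right, Complex.cpow_natCast, smul_eq_mul]
    using (hasMellin_meijerG_natCast_add_one hrs hc hn).1

theorem integral_pow_mul_meijerG (hrs : 0 < r + s) (hc : IsMeijerLine r s a b c) {n : ℕ}
    (hn : IsMeijerLine r s a b (-((n : ℝ) + 1))) :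
    ∫ x in Ioi (0 : ℝ), (x : ℂ) ^ n * meijerG r s a b c x =
      meijerSymbol r s a b (-((n : ℂ) + 1)) := by
  simpa only [mellin, add_sub_cancel_right, Complex.cpow_natCast, smul_eq_mul]
    using (hasMellin_meijerG_natCast_add_one hrs hc hn).2

end MeijerG

section Andreief

variable {n : Type*} [Fintype n] [DecidableEq n]

theorem det_mul_det_eq_sum_sum {R : Type*} [CommRing R] (A B : Matrix n n R) :
    A.det * B.det = ∑ σ : Equiv.Perm n, ∑ τ : Equiv.Perm n,
      ((σ.sign : ℤ) : R) * ((τ.sign : ℤ) : R) * ∏ k, A (σ k) k * B (τ k) k := by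
  simp only [Matrix.det_apply', Finset.sum_mul_sum, Finset.prod_mul_distrib]
  refine Finset.sum_congr rfl fun σ _ => Finset.sum_congr rfl fun τ _ => ?_
  ring

theorem sum_sum_sign_mul_prod {R : Type*} [CommRing R] (M : Matrix n n R) :
    ∑ σ : Equiv.Perm n, ∑ τ : Equiv.Perm n,
      ((σ.sign : ℤ) : R) * ((τ.sign : ℤ) : R) * ∏ k, M (σ k) (τ k) =
      (Fintype.card n).factorial * M.det := by
  have hrow (σ : Equiv.Perm n) : ∑ τ : Equiv.Perm n,
      ((σ.sign : ℤ) : R) * ((τ.sign : ℤ) : R) * ∏ k, M (σ k) (τ k) = M.det := by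
    calc _ = ((σ.sign : ℤ) : R) * (M.submatrix σ id).det := by
          rw [← Matrix.det_transpose, Matrix.det_apply', Finset.mul_sum]
          simp only [mul_assoc, Matrix.transpose_apply, Matrix.submatrix_apply, id_eq]
      _ = M.det := by
          rw [Matrix.det_permute, ← mul_assoc, ← Int.cast_mul, Int.units_coe_mul_self,
            Int.cast_one, one_mul]
  simp only [hrow, Finset.sum_const, Finset.card_univ, Fintype.card_perm, nsmul_eq_mul]

variable {𝕜 α : Type*} [RCLike 𝕜] [MeasurableSpace α] {μ : Measure α} [SigmaFinite μ]
  {f g : n → α → 𝕜}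

theorem integrable_prod_perm_mul (h : ∀ i j, Integrable (fun x => f i x * g j x) μ)
    (σ τ : Equiv.Perm n) :
    Integrable (fun x : n → α => ((σ.sign : ℤ) : 𝕜) * ((τ.sign : ℤ) : 𝕜) *
      ∏ k, f (σ k) (x k) * g (τ k) (x k)) (Measure.pi fun _ => μ) :=
  (Integrable.fintype_prod fun k => h (σ k) (τ k)).const_mul _

theorem integrable_det_mul_det (h : ∀ i j, Integrable (fun x => f i x * g j x) μ) :
    Integrable (fun x : n → α => (Matrix.of fun i k => f i (x k)).det *
      (Matrix.of fun j k => g j (x k)).det) (Measure.pi fun _ => μ) := by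
  simp only [det_mul_det_eq_sum_sum, Matrix.of_apply]
  exact integrable_finsetSum _ fun σ _ => integrable_finsetSum _ fun τ _ =>
    integrable_prod_perm_mul h σ τ

theorem integral_det_mul_det (h : ∀ i j, Integrable (fun x => f i x * g j x) μ) :
    ∫ x : n → α, (Matrix.of fun i k => f i (x k)).det * (Matrix.of fun j k => g j (x k)).det
      ∂(Measure.pi fun _ => μ) =
    (Fintype.card n).factorial * (Matrix.of fun i j => ∫ x, f i x * g j x ∂μ).det := by
  simp only [det_mul_det_eq_sum_sum, Matrix.of_apply]
  rw [integral_finsetSum _ fun σ _ => integrable_finsetSum _ fun τ _ =>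
    integrable_prod_perm_mul h σ τ, ← sum_sum_sign_mul_prod]
  refine Finset.sum_congr rfl fun σ _ => ?_
  rw [integral_finsetSum _ fun τ _ => integrable_prod_perm_mul h σ τ]
  refine Finset.sum_congr rfl fun τ _ => ?_
  rw [integral_const_mul, integral_fintype_prod_eq_prod fun k x => f (σ k) x * g (τ k) x]
  simp only [Matrix.of_apply]

end Andreief

section GammaDeterminant

theorem det_Gamma_add {N : ℕ} (z : Fin N → ℂ) (hz : ∀ p, ∀ m : ℕ, z p ≠ -m) :
    (Matrix.of fun p j : Fin N => Complex.Gamma (z p + (j.val : ℂ))).det =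
      (∏ p, Complex.Gamma (z p)) * (Matrix.vandermonde z).det := by
  have hentry (p j : Fin N) : Complex.Gamma (z p + (j.val : ℂ)) =
      Complex.Gamma (z p) * (ascPochhammer ℂ j.val).eval (z p) := by
    rw [← Complex.Gamma_add_nat_div_Gamma_eq _ (hz p),
      mul_div_cancel₀ _ (Complex.Gamma_ne_zero (hz p))]
  simp only [hentry]
  rw [Matrix.det_eval_matrixOfPolynomials_eq_det_vandermonde z
    (fun j => ascPochhammer ℂ j.val) (fun j => ascPochhammer_natDegree _ _)
    (fun j => monic_ascPochhammer _ _), ← Matrix.det_mul_column]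
  simp only [Matrix.of_apply]

theorem det_vandermonde_sub_val {R : Type*} [CommRing R] (N : ℕ) (z : R) :
    (Matrix.vandermonde fun p : Fin N => z - (p.val : R)).det =
      ∏ l ∈ Finset.range N, ((-1) ^ l * (l.factorial : R)) := by
  have hsign : (Matrix.vandermonde fun p : Fin N => z - (p.val : R)).det =
      (∏ l : Fin N, (-1 : R) ^ l.val) * (Matrix.vandermonde fun p : Fin N => (p.val : R)).det := by
    rw [← Matrix.det_mul_row, ← Matrix.det_vandermonde_add (fun p : Fin N => z - (p.val : R)) (-z)]
    congr with p j
    simp only [Matrix.vandermonde_apply, Matrix.of_apply, ← mul_pow]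
    ring
  rw [hsign, Finset.prod_mul_distrib, Fin.prod_univ_eq_prod_range fun l => (-1 : R) ^ l]
  congr 1
  cases N with
  | zero => simp
  | succ N =>
    rw [Matrix.det_vandermonde_id_eq_superFactorial, ← Nat.prod_range_succ_factorial,
      Nat.cast_prod]

end GammaDeterminant

section EigenvalueWeight

variable {N r s : ℕ} {ν : Fin r → ℝ}

theorem meijerSymbol_upperParam_lowerParam (ν : Fin r → ℝ) (μ : Fin (s + 1) → ℝ) (j : Fin N)
    (u : ℂ) :
    meijerSymbol r (s + 1) (upperParam μ j) (lowerParam ν) u =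
      (∏ l, Complex.Gamma (ν l - u)) * (Complex.Gamma (μ 0 + N + 1 + j.val + u) *
        ∏ l : Fin s, Complex.Gamma (μ l.succ + N + 1 + u)) := by
  simp only [meijerSymbol_eq_prod_Gamma, lowerParam, upperParam, Fin.prod_univ_succ, Fin.val_zero,
    Fin.val_succ, Nat.add_one_ne_zero, if_true, if_false]
  congr! 4 <;> ring

theorem ofReal_normConst (N : ℕ) (ν : Fin r → ℝ) (μ : Fin (s + 1) → ℝ) (l : ℕ) :
    (normConst N ν μ l : ℂ) =
      (∏ j, Complex.Gamma (ν j + l + 1)) * (∏ p : Fin s, Complex.Gamma (μ p.succ + N - l)) *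
        Complex.Gamma (μ 0 + N - l) * ((-1) ^ l * l.factorial) := by
  simp only [normConst, Fin.prod_univ_succ, Fin.cons_zero, Fin.cons_succ, zero_add,
    Real.Gamma_nat_eq_factorial]
  push_cast
  simp only [← Complex.Gamma_ofReal]
  push_cast
  ring

theorem normConst_ne_zero {μ : Fin s → ℝ} (hν : ∀ l, -1 < ν l) (hμ : ∀ l, -1 < μ l) {l : ℕ}
    (hl : l < N) : normConst N ν μ l ≠ 0 := by
  have hlN : (l : ℝ) + 1 ≤ N := by exact_mod_cast hl
  have hcons (j : Fin (r + 1)) : -1 < (Fin.cons 0 ν : Fin (r + 1) → ℝ) j := by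
    cases j using Fin.cases <;> simp [hν]
  refine mul_ne_zero (mul_ne_zero (by simp) (Finset.prod_ne_zero_iff.2 fun j _ => ?_))
    (Finset.prod_ne_zero_iff.2 fun p _ => ?_)
  · exact (Real.Gamma_pos_of_pos (by linarith [hcons j, l.cast_nonneg (α := ℝ)])).ne'
  · exact (Real.Gamma_pos_of_pos (by linarith [hμ p])).ne'

theorem det_meijerSymbol (hs : 1 ≤ s) (ν : Fin r → ℝ) {μ : Fin s → ℝ} (hμ : ∀ l, -1 < μ l) :
    (Matrix.of fun p j : Fin N =>
      meijerSymbol r s (upperParam μ j) (lowerParam ν) (-((p.val : ℂ) + 1))).det =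
      ∏ l ∈ Finset.range N, (normConst N ν μ l : ℂ) := by
  obtain ⟨s, rfl⟩ := Nat.exists_eq_add_of_le' hs
  let z (p : Fin N) : ℂ := (μ 0 + N : ℂ) - p.val
  let A (p : Fin N) : ℂ := (∏ l, Complex.Gamma (ν l + p.val + 1)) *
    ∏ l : Fin s, Complex.Gamma (μ l.succ + N - p.val)
  have hz (p : Fin N) (m : ℕ) : z p ≠ -m := fun h => by
    have hre : μ 0 + N - p.val = -m := by simpa [z] using congrArg Complex.re h
    have hpN : (p.val : ℝ) + 1 ≤ N := by exact_mod_cast p.isLt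
    linarith [hμ 0, m.cast_nonneg (α := ℝ)]
  have hentry (p j : Fin N) :
      meijerSymbol r (s + 1) (upperParam μ j) (lowerParam ν) (-((p.val : ℂ) + 1)) =
        A p * (Matrix.of fun p j : Fin N => Complex.Gamma (z p + (j.val : ℂ))) p j := by
    rw [meijerSymbol_upperParam_lowerParam, mul_comm (Complex.Gamma _), ← mul_assoc]
    simp only [A, z, Matrix.of_apply]
    congr 1
    · congr! 3 <;> ring
    · ring_nf
  simp only [hentry]
  rw [Matrix.det_mul_column, det_Gamma_add z hz, det_vandermonde_sub_val, ← mul_assoc,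
    ← Finset.prod_mul_distrib, ← Fin.prod_univ_eq_prod_range,
    ← Fin.prod_univ_eq_prod_range (fun l => (normConst N ν μ l : ℂ)), ← Finset.prod_mul_distrib]
  simp only [ofReal_normConst, A, z]

variable {μ : Fin s → ℝ} {c : Fin N → ℝ}

theorem isMeijerLine_neg_add_one (hν : ∀ l, -1 < ν l) (hμ : ∀ l, -1 < μ l) (j p : Fin N) :
    IsMeijerLine r s (upperParam μ j) (lowerParam ν) (-((p.val : ℝ) + 1)) := by
  have hpN : (p.val : ℝ) + 1 ≤ N := by exact_mod_cast p.isLt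
  refine ⟨fun l _ => ?_, fun l _ => ?_⟩
  · simp only [lowerParam, Complex.ofReal_re]
    linarith [hν l, p.val.cast_nonneg (α := ℝ)]
  · unfold upperParam
    split_ifs <;> simp <;> linarith [hμ l, j.val.cast_nonneg (α := ℝ)]

theorem eigenvalueWeight_eq_det_mul_det (ν : Fin r → ℝ) (μ : Fin s → ℝ) (c x : Fin N → ℝ) :
    eigenvalueWeight ν μ c x = (Matrix.of fun p k : Fin N => (x k : ℂ) ^ p.val).det *
      (Matrix.of fun j k : Fin N =>
        meijerG r s (upperParam μ j) (lowerParam ν) (c j) (x k)).det := by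
  rw [eigenvalueWeight, ← Matrix.det_vandermonde fun k => (x k : ℂ), ← Matrix.det_transpose]
  rfl

theorem im_eigenvalueWeight (ν : Fin r → ℝ) (μ : Fin s → ℝ) (c : Fin N → ℝ) {x : Fin N → ℝ}
    (hx : ∀ k, 0 ≤ x k) : (eigenvalueWeight ν μ c x).im = 0 := by
  have hG (j k : Fin N) : conj (meijerG r s (upperParam μ j) (lowerParam ν) (c j) (x k)) =
      meijerG r s (upperParam μ j) (lowerParam ν) (c j) (x k) := by
    rw [conj_meijerG, Complex.conj_ofReal]
    · intro l
      unfold upperParam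
      split_ifs <;> simp
    · simp [lowerParam]
    · rw [Complex.arg_ofReal_of_nonneg (hx k)]
      exact Real.pi_ne_zero.symm
  rw [← Complex.conj_eq_iff_im, eigenvalueWeight_eq_det_mul_det, map_mul, RingHom.map_det,
    RingHom.map_det]
  congr 2
  · ext p k
    simp
  · ext j k
    exact hG j k

theorem integrableOn_eigenvalueWeight (hs : 1 ≤ s) (hν : ∀ l, -1 < ν l) (hμ : ∀ l, -1 < μ l)
    (hc : ∀ j : Fin N, IsMeijerLine r s (upperParam μ j) (lowerParam ν) (c j)) :
    IntegrableOn (eigenvalueWeight ν μ c) (univ.pi fun _ : Fin N => Ioi (0 : ℝ)) := by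
  have hrs : 0 < r + s := by omega
  have hline := isMeijerLine_neg_add_one (N := N) hν hμ
  rw [IntegrableOn, volume_pi, Measure.restrict_pi_pi]
  refine (integrable_det_mul_det fun p j =>
    integrableOn_pow_mul_meijerG hrs (hc j) (hline j p)).congr (ae_of_all _ fun x => ?_)
  exact (eigenvalueWeight_eq_det_mul_det ν μ c x).symm

theorem integral_eigenvalueWeight (hs : 1 ≤ s) (hν : ∀ l, -1 < ν l) (hμ : ∀ l, -1 < μ l)
    (hc : ∀ j : Fin N, IsMeijerLine r s (upperParam μ j) (lowerParam ν) (c j)) :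
    ∫ x in univ.pi (fun _ : Fin N => Ioi (0 : ℝ)), eigenvalueWeight ν μ c x =
      N.factorial * ∏ l ∈ Finset.range N, (normConst N ν μ l : ℂ) := by
  have hrs : 0 < r + s := by omega
  have hline := isMeijerLine_neg_add_one (N := N) hν hμ
  simp only [eigenvalueWeight_eq_det_mul_det]
  rw [volume_pi, Measure.restrict_pi_pi, integral_det_mul_det fun p j =>
    integrableOn_pow_mul_meijerG hrs (hc j) (hline j p), Fintype.card_fin,
    ← det_meijerSymbol hs ν hμ]
  simp only [integral_pow_mul_meijerG hrs (hc _) (hline _ _)]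

end EigenvalueWeight

theorem mainTheorem8 (N r s : ℕ) (hs : 1 ≤ s) (ν : Fin r → ℝ) (μ : Fin s → ℝ)
    (hν : ∀ l, -1 < ν l) (hμ : ∀ l, -1 < μ l) (c : Fin N → ℝ)
    (hc : ∀ j : Fin N, IsMeijerLine r s (upperParam μ j) (lowerParam ν) (c j)) :
    (∀ x : Fin N → ℝ, (∀ k, 0 < x k) → (eigenvalueWeight ν μ c x).im = 0) ∧
    MeasureTheory.IntegrableOn (eigenvalueWeight ν μ c)
      (Set.univ.pi fun _ : Fin N => Set.Ioi (0 : ℝ)) MeasureTheory.volume ∧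
    (∀ K : ℂ,
      (∫ x in Set.univ.pi (fun _ : Fin N => Set.Ioi (0 : ℝ)), K * eigenvalueWeight ν μ c x) = 1 ↔
        K = 1 / (N.factorial : ℂ) *
          (1 / ∏ l ∈ Finset.range N, ((normConst N ν μ l : ℝ) : ℂ))) := by
  refine ⟨fun x hx => im_eigenvalueWeight ν μ c fun k => (hx k).le,
    integrableOn_eigenvalueWeight hs hν hμ hc, fun K => ?_⟩
  have hprod : ∏ l ∈ Finset.range N, (normConst N ν μ l : ℂ) ≠ 0 :=
    Finset.prod_ne_zero_iff.2 fun l hl =>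
      Complex.ofReal_ne_zero.2 (normConst_ne_zero hν hμ (Finset.mem_range.1 hl))
  have hfactorial : (N.factorial : ℂ) ≠ 0 := Nat.cast_ne_zero.2 N.factorial_ne_zero
  rw [integral_const_mul, integral_eigenvalueWeight hs hν hμ hc, one_div_mul_one_div,
    eq_div_iff (mul_ne_zero hfactorial hprod)]
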